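/- Let $d\ge 1$, let $\Omega\subseteq\mathbb{R}^d$ be open and let $f:\Omega\to\mathbb{R}$ be continuous. Put $\mathrm{hypo}(f)=\{(y,\beta)\in\Omega\times\mathbb{R}:\beta\le f(y)\}$ and, for $x\in\Omega$, let $$N(x)=\{v\in\mathbb{R}^{d+1}:\ \exists\,\sigma\ge 0\ \ \forall\, p\in\mathrm{hypo}(f):\ v\cdot(p-(x,f(x)))\le\sigma\,|p-(x,f(x))|^2\}$$ be the proximal normal cone to $\mathrm{hypo}(f)$ at $(x,f(x))$. Define - $\partial^Pf(x)=\{v\in\mathbb{R}^d:(-v,1)\in N(x)\}$ and $\partial^\infty f(x)=\{v\in\mathbb{R}^d:(-v,0)\in N(x)\}$; - $\partial^*f(x)$, the set of reachable gradients: all $v=\lim_n Df(x_n)$, where $x_n\in\Omega\setminus\{x\}$ are points of differentiability of $f$ with $x_n\to x$; - $\partial^{*,\infty}f(x)$, the set of horizontal reachable gradients: all $v\ne 0$ such that $v/|v|=\lim_n Df(x_n)/|Df(x_n)|$ and $|Df(x_n)|\to\infty$ for some sequence of points of differentiability $x_n\in\Omega\setminus\{x\}$ of $f$ with $x_n\to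 x$. For $S\subseteq\mathbb{R}^d$ and $c\in\mathbb{R}$ write $(-S,c)=\{(-v,c):v\in S\}$. A cone is a set $C$ with $tv\in C$ for all $v\in C$, $t\ge 0$; it is pointed if $C\cap(-C)=\{0\}$. An exposed ray of a convex cone $C\subseteq\mathbb{R}^{d+1}$ is a half line $\mathbb{R}^+\zeta=\{t\zeta:t\ge 0\}\subseteq C$, $\zeta\neq 0$, for which there is a unit vector $e\in\mathbb{R}^{d+1}$ with $\zeta\cdot e=0$ and $w\cdot e<0$ for all $w\in C\setminus(\mathbb{R}^+\zeta\cup\{0\})$. Convex hulls are denoted by $\mathrm{co}$. Assume that $\mathrm{hypo}(f)$ satisfies the $\rho(\cdot)$-exterior sphere condition for some continuous $\rho:\Omega\to(0,\infty)$: for every $x\in\Omega$ there is a nonzero $v_x\in N(x)$ such that $$v_x\cdot(p-(x,f(x)))\le\frac{|v_x|}{2\rho(x)}\,|p-(x,f(x))|^2\qquad\text{for all } p\in\mathrm{hypo}(f).$$ Then for every $x\in\Omega$ the following hold. (i) The set $\partial^*f(x)\cup\partial^{*,\infty}f(x)$ is non-empty and $$(-\partial^*f(x),1)\cup(-\partial^{*,\infty}f(x),0)\subseteq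 N(x).$$ (ii) Let $C(x)$ be a closed convex cone with $(-\partial^*f(x),1)\cup(-\partial^{*,\infty}f(x),0)\subseteq C(x)\subseteq N(x)$. If a unit vector $(-\xi,\lambda)\in\mathbb{R}^d\times[0,\infty)$ belongs to an exposed ray of $C(x)$, then $$(-\xi,\lambda)\in\Big\{\frac{\zeta}{|\zeta|}:\zeta\in(-\partial^*f(x),1)\Big\}\cup(-\partial^{*,\infty}f(x),0).$$ (iii) If $N(x)$ is pointed, then it is closed and $$N(x)=\mathrm{co}\big\{\lambda v:\lambda\in[0,\infty),\ v\in(-\partial^{*,\infty}f(x),0)\cup(-\partial^*f(x),1)\big\}.$$ Moreover $$\partial^\infty f(x)=\mathrm{co}\big[\partial^{*,\infty}f(x)\cup\{0\}\big],\qquad \partial^Pf(x)=\mathrm{co}\big[\partial^*f(x)\big]+\partial^\infty f(x).$$ -/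

import Mathlib

open Filter Topology
open scoped Pointwise

noncomputable section

namespace HypoSphere

section Cones

variable {H : Type*} [NormedAddCommGroup H] [InnerProductSpace ℝ H]

/-- The proximal normal cone to `Q` at a point `x` of `Q`. -/
def proximalNormalCone (Q : Set H) (x : H) : Set H :=
  {v | ∃ σ : ℝ, 0 ≤ σ ∧ ∀ y ∈ Q, inner ℝ v (y - x) ≤ σ * ‖y - x‖ ^ 2}

/-- The vector `v` is a proximal normal to `Q` at `x` that is realized by a ball of radius `r`:
the proximal inequality holds with `σ = ‖v‖ / (2 r)`. -/
def RealizedByBall (Q : Set H) (x v : H) (r : ℝ) : Prop :=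
  ∀ y ∈ Q, inner ℝ v (y - x) ≤ ‖v‖ / (2 * r) * ‖y - x‖ ^ 2

/-- A cone: a set that is stable under multiplication by nonnegative scalars. -/
def IsCone (C : Set H) : Prop :=
  ∀ v ∈ C, ∀ t : ℝ, 0 ≤ t → t • v ∈ C

/-- A cone is pointed if it meets its opposite only at the origin. -/
def IsPointed (C : Set H) : Prop :=
  C ∩ (-C) = {0}

/-- The half line generated by `ζ`. -/
def halfLine (ζ : H) : Set H :=
  {w | ∃ t : ℝ, 0 ≤ t ∧ w = t • ζ}

/-- `R` is an exposed ray of the convex cone `C`: a half line contained in `C`, orthogonal to some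
unit vector `e` that has negative inner product with every other nonzero element of `C`. -/
def IsExposedRay (C R : Set H) : Prop :=
  ∃ ζ : H, ζ ≠ 0 ∧ R = halfLine ζ ∧ R ⊆ C ∧
    ∃ e : H, ‖e‖ = 1 ∧ inner ℝ ζ e = 0 ∧ ∀ w ∈ C \ (R ∪ {0}), inner ℝ w e < 0

end Cones

section Hypograph

variable {d : ℕ}

/-- The hypograph of `f : Ω → ℝ`, as a subset of the Euclidean space `ℝᵈ × ℝ = ℝᵈ⁺¹`
(`WithLp 2` gives the product its Euclidean norm and inner product). -/
def hypo (Ω : Set (EuclideanSpace ℝ (Fin d))) (f : EuclideanSpace ℝ (Fin d) → ℝ) :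
    Set (WithLp 2 (EuclideanSpace ℝ (Fin d) × ℝ)) :=
  {p | p.fst ∈ Ω ∧ p.snd ≤ f p.fst}

/-- The proximal normal cone to the hypograph of `f` at `(x, f x)`. -/
def hypoNormalCone (Ω : Set (EuclideanSpace ℝ (Fin d))) (f : EuclideanSpace ℝ (Fin d) → ℝ)
    (x : EuclideanSpace ℝ (Fin d)) : Set (WithLp 2 (EuclideanSpace ℝ (Fin d) × ℝ)) :=
  proximalNormalCone (hypo Ω f) (WithLp.toLp 2 (x, f x))

/-- The hypograph of `f` satisfies the `ρ(·)`-exterior sphere condition. -/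
def HypoExteriorSphere (Ω : Set (EuclideanSpace ℝ (Fin d))) (f : EuclideanSpace ℝ (Fin d) → ℝ)
    (ρ : EuclideanSpace ℝ (Fin d) → ℝ) : Prop :=
  ∀ x ∈ Ω, ∃ v : WithLp 2 (EuclideanSpace ℝ (Fin d) × ℝ), v ≠ 0 ∧ v ∈ hypoNormalCone Ω f x ∧
    RealizedByBall (hypo Ω f) (WithLp.toLp 2 (x, f x)) v (ρ x)

/-- The set of proximal supergradients of `f` at `x`. -/
def proxSupergradients (Ω : Set (EuclideanSpace ℝ (Fin d))) (f : EuclideanSpace ℝ (Fin d) → ℝ)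
    (x : EuclideanSpace ℝ (Fin d)) : Set (EuclideanSpace ℝ (Fin d)) :=
  {v | WithLp.toLp 2 (-v, (1 : ℝ)) ∈ hypoNormalCone Ω f x}

/-- The set of proximal horizontal supergradients of `f` at `x`. -/
def horizProxSupergradients (Ω : Set (EuclideanSpace ℝ (Fin d)))
    (f : EuclideanSpace ℝ (Fin d) → ℝ) (x : EuclideanSpace ℝ (Fin d)) :
    Set (EuclideanSpace ℝ (Fin d)) :=
  {v | WithLp.toLp 2 (-v, (0 : ℝ)) ∈ hypoNormalCone Ω f x}

/-- The set of reachable gradients of `f` at `x`. -/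
def reachableGradients (Ω : Set (EuclideanSpace ℝ (Fin d))) (f : EuclideanSpace ℝ (Fin d) → ℝ)
    (x : EuclideanSpace ℝ (Fin d)) : Set (EuclideanSpace ℝ (Fin d)) :=
  {v | ∃ u : ℕ → EuclideanSpace ℝ (Fin d),
    (∀ n, u n ∈ Ω \ {x} ∧ DifferentiableAt ℝ f (u n)) ∧
    Tendsto u atTop (𝓝 x) ∧ Tendsto (fun n => gradient f (u n)) atTop (𝓝 v)}

/-- The set of (nonzero) horizontal reachable gradients of `f` at `x`. -/
def horizReachableGradients (Ω : Set (EuclideanSpace ℝ (Fin d)))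
    (f : EuclideanSpace ℝ (Fin d) → ℝ) (x : EuclideanSpace ℝ (Fin d)) :
    Set (EuclideanSpace ℝ (Fin d)) :=
  {v | v ≠ 0 ∧ ∃ u : ℕ → EuclideanSpace ℝ (Fin d),
    (∀ n, u n ∈ Ω \ {x} ∧ DifferentiableAt ℝ f (u n)) ∧
    Tendsto u atTop (𝓝 x) ∧
    Tendsto (fun n => ‖gradient f (u n)‖⁻¹ • gradient f (u n)) atTop (𝓝 (‖v‖⁻¹ • v)) ∧
    Tendsto (fun n => ‖gradient f (u n)‖) atTop atTop}

/-- The set `(-S, c) = {(-v, c) : v ∈ S}` in `ℝᵈ × ℝ`. -/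
def negLift (S : Set (EuclideanSpace ℝ (Fin d))) (c : ℝ) :
    Set (WithLp 2 (EuclideanSpace ℝ (Fin d) × ℝ)) :=
  (fun v => WithLp.toLp 2 (-v, c)) '' S

end Hypograph

end HypoSphere

end

noncomputable section

namespace HypoSphere

/-! The core is a transfer principle: if a proximal normal `ζ` at `(x, f x)` satisfies `ζ · u > 0`,
then arbitrarily close to `x`, and different from `x`, there are points `y` of differentiability
with `(-Df(y), 1) · u > 0` (`exists_diffPoint_inner_pos`). Otherwise `Df(y) · a ≥ b` at all such
`y`, where `u = (a, b)`. Wherever a differentiable function touches `f` from below, the nonzero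
normal given by the sphere condition forces `f` to be differentiable (`hasGradientAt_of_touching`),
so the bound holds for every touching slope. A mean value inequality (`le_add_of_touching`) then
gives `f(x + T a) ≥ f(x) + T b` for small `T > 0`. Thus the hypograph contains the segment leaving
`(x, f x)` in the direction `u`, which contradicts `ζ · u > 0`.

Compactness of the unit sphere turns this into the statement that every `u` with `ζ · u ≥ 0` has
nonnegative product with some limit of unit gradient normals (`exists_limitNormal_inner_nonneg`).
These limits are exactly of the two reachable kinds (`limitNormals_subset`). They are proximal
normals because the gradient normals are realized by balls of radius `ρ`, which is continuous and
positive.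

Part (i) follows with `u = 0`, and part (ii) by taking for `u` the vector that exposes the ray. For
(iii), Hahn–Banach puts a multiple `t • ζ` in the convex hull of the limit normals
(`exists_smul_mem_convexHull`); pointedness excludes `t = 0`. This also works for `ζ` in the closure
of the cone, whence closedness. The two formulas for the supergradients come from separating the
horizontal and non-horizontal terms of a convex combination
(`decompose_of_mem_convexHull_reachableRays`). -/

/-- In finite dimension the convex hull of a compact set is compact. -/
theorem isCompact_convexHull_of_finiteDimensional {V : Type*} [NormedAddCommGroup V]
    [NormedSpace ℝ V] [FiniteDimensional ℝ V] {s : Set V} (hs : IsCompact s) :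
    IsCompact (convexHull ℝ s) := by
  let T : ℕ → Set V := fun m =>
    (fun p : (Fin m → ℝ) × (Fin m → V) => ∑ i, p.1 i • p.2 i) ''
      (stdSimplex ℝ (Fin m) ×ˢ Set.pi Set.univ fun _ => s)
  have hT : ∀ m, IsCompact (T m) := fun m =>
    ((isCompact_stdSimplex ℝ (Fin m)).prod (isCompact_univ_pi fun _ => hs)).image (by fun_prop)
  -- By Carathéodory at most `finrank + 1` points are needed, so `m` ranges below `finrank + 2`.
  have heq : convexHull ℝ s = ⋃ m ∈ Finset.range (Module.finrank ℝ V + 2), T m := by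
    apply Set.Subset.antisymm
    · intro v hv
      obtain ⟨ι, _, z, w, hz, hind, hw, hw1, hwz⟩ := eq_pos_convex_span_of_mem_convexHull hv
      have hcard : Fintype.card ι ≤ Module.finrank ℝ V + 1 :=
        hind.card_le_finrank_succ.trans (Nat.succ_le_succ (Submodule.finrank_le _))
      refine Set.mem_biUnion (x := Fintype.card ι) (by simpa using by omega) ?_
      let g := (Fintype.equivFin ι).symm
      refine ⟨(w ∘ g, z ∘ g), ⟨⟨fun i => (hw _).le, ?_⟩, fun i _ => hz ⟨_, rfl⟩⟩, ?_⟩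
      · rw [← hw1]; exact g.sum_comp w
      · rw [← hwz]; exact g.sum_comp (fun i => w i • z i)
    · intro v hv
      simp only [Set.mem_iUnion] at hv
      obtain ⟨m, -, ⟨w, z⟩, ⟨⟨hw, hw1⟩, hz⟩, rfl⟩ := hv
      exact (convex_convexHull ℝ s).sum_mem (fun i _ => hw i) hw1
        fun i _ => subset_convexHull ℝ s (hz i trivial)
  rw [heq]
  exact (Finset.range _).isCompact_biUnion fun m _ => hT m

/-! ### Mean value inequality from touching functions -/

/-- A function that decreases along a segment is touched from below, near the segment, by a smooth
function that decreases strictly in the direction of the segment. -/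
theorem le_add_of_touching {E : Type*} [NormedAddCommGroup E] [InnerProductSpace ℝ E]
    [FiniteDimensional ℝ E] {f : E → ℝ} {x a : E} {b ε T : ℝ} (ha : a ≠ 0)
    (hf : ContinuousOn f (Metric.ball x ε)) (hT : 0 < T) (hTε : T * ‖a‖ < ε)
    (htouch : ∀ y ∈ Metric.ball x ε, y ≠ x → ∀ (θ : E → ℝ) (θ' : E →L[ℝ] ℝ),
      HasFDerivAt θ θ' y → IsLocalMin (fun z => f z - θ z) y → b ≤ θ' a) :
    f x + T * b ≤ f (x + T • a) := by
  by_contra! hlt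
  have ha2 : 0 < ‖a‖ := norm_pos_iff.2 ha
  -- Coordinates along the segment: `s` is the parameter in the direction `a`, `z` the component
  -- orthogonal to `a`.
  let s : E → ℝ := fun y => inner ℝ a (y - x) / ‖a‖ ^ 2
  let z : E → E := fun y => y - x - s y • a
  have hs_cont : Continuous s := by fun_prop
  have hz_cont : Continuous z := by fun_prop
  have hdecomp : ∀ y, y = x + s y • a + z y := fun y => by simp only [z]; abel
  have hs_add : ∀ y (t : ℝ), s (y + t • a) = s y + t := fun y t => by
    simp only [s]
    rw [show y + t • a - x = (y - x) + t • a by abel, inner_add_right, inner_smul_right,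
      real_inner_self_eq_norm_sq]
    field_simp
  have hs_line : ∀ t : ℝ, s (x + t • a) = t := fun t => by
    rw [hs_add]; simp [s]
  have hz_add : ∀ y (t : ℝ), z (y + t • a) = z y := fun y t => by
    simp only [z, hs_add]; module
  have hz_line : ∀ t : ℝ, z (x + t • a) = 0 := fun t => by
    rw [hz_add]; simp [z, s]
  have hball : ∀ t, 0 ≤ t → t ≤ T → x + t • a ∈ Metric.ball x ε := fun t h0 h1 => by
    rw [Metric.mem_ball, dist_eq_norm, add_sub_cancel_left, norm_smul, Real.norm_of_nonneg h0]
    exact (mul_le_mul_of_nonneg_right h1 ha2.le).trans_lt hTε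
  let h : ℝ → ℝ := fun t => f (x + t • a) - t * b
  have hh_cont : ContinuousOn h (Set.Icc 0 T) := by
    refine ContinuousOn.sub (hf.comp (by fun_prop) fun t ht => hball t ht.1 ht.2) (by fun_prop)
  have hh0 : h T < h 0 := by simp only [h, zero_smul, add_zero]; linarith
  -- two interior parameters between which `h` still decreases
  obtain ⟨t₀, ht₀, ht₀T, hht₀⟩ : ∃ t₀, 0 < t₀ ∧ t₀ < T ∧ h T < h t₀ := by
    have h1 : ∀ᶠ t in 𝓝[Set.Icc 0 T] 0, h T < h t :=
      (hh_cont 0 ⟨le_rfl, hT.le⟩).eventually (lt_mem_nhds hh0)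
    have h2 : ∀ᶠ t in 𝓝[>] (0 : ℝ), t ∈ Set.Ioo 0 T := Ioo_mem_nhdsGT hT
    have h3 : ∀ᶠ t in 𝓝[>] (0 : ℝ), h T < h t := by
      rw [← nhdsWithin_Ioo_eq_nhdsGT hT]
      exact nhdsWithin_mono _ Set.Ioo_subset_Icc_self h1
    obtain ⟨t, ht, ht'⟩ := (h2.and h3).exists
    exact ⟨t, ht.1, ht.2, ht'⟩
  obtain ⟨t₁, ht₀₁, ht₁T, hht₁⟩ : ∃ t₁, t₀ < t₁ ∧ t₁ < T ∧ h t₁ < h t₀ := by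
    have h1 : ∀ᶠ t in 𝓝[Set.Icc 0 T] T, h t < h t₀ :=
      (hh_cont T ⟨hT.le, le_rfl⟩).eventually (gt_mem_nhds hht₀)
    have h2 : ∀ᶠ t in 𝓝[<] T, t ∈ Set.Ioo t₀ T := Ioo_mem_nhdsLT ht₀T
    have h3 : ∀ᶠ t in 𝓝[<] T, h t < h t₀ := by
      rw [← nhdsWithin_Ioo_eq_nhdsLT hT]
      exact nhdsWithin_mono _ Set.Ioo_subset_Icc_self h1
    obtain ⟨t, ht, ht'⟩ := (h2.and h3).exists
    exact ⟨t, ht.1, ht.2, ht'⟩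
  obtain ⟨η, hη, hη'⟩ : ∃ η, 0 < η ∧ h t₁ + η < h t₀ :=
    ⟨(h t₀ - h t₁) / 2, by linarith, by linarith⟩
  -- The exponential equals `1` at `t₁` and is as large as desired at `T`; this keeps the minimum
  -- below away from the far end of the tube.
  obtain ⟨M, hM, hM'⟩ : ∃ M, 0 < M ∧ h t₁ + η < h T - 1 + η * Real.exp (M * (T - t₁)) := by
    have : Tendsto (fun M : ℝ => h T - 1 + η * Real.exp (M * (T - t₁))) atTop atTop :=
      tendsto_atTop_add_const_left _ _ ((Real.tendsto_exp_atTop.comp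
        (tendsto_id.atTop_mul_const (sub_pos.2 ht₁T))).const_mul_atTop hη)
    obtain ⟨M, h1, h2⟩ := ((eventually_gt_atTop 0).and (this.eventually_gt_atTop _)).exists
    exact ⟨M, h1, h2⟩
  -- a thin tube around the segment
  have hcap : ∀ t, 0 ≤ t → t ≤ T → ∀ c, c < h t →
      ∀ᶠ r in 𝓝[>] (0 : ℝ), ∀ w : E, ‖w‖ ≤ r → c < f (x + t • a + w) - t * b := by
    intro t h0 h1 c hc
    have hat : ContinuousAt f (x + t • a) :=
      hf.continuousAt (Metric.isOpen_ball.mem_nhds (hball t h0 h1))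
    have : ∀ᶠ y in 𝓝 (x + t • a), c < f y - t * b :=
      (hat.sub continuousAt_const).eventually (lt_mem_nhds hc)
    obtain ⟨δ, hδ, hδ'⟩ := Metric.eventually_nhds_iff.1 this
    filter_upwards [Ioo_mem_nhdsGT hδ] with r hr w hw
    exact hδ' (by simpa [dist_eq_norm] using hw.trans_lt hr.2)
  obtain ⟨r, hr, hrε, hcap₀, hcapT⟩ : ∃ r, 0 < r ∧ T * ‖a‖ + r < ε ∧
      (∀ w : E, ‖w‖ ≤ r → h t₁ + η < f (x + t₀ • a + w) - t₀ * b) ∧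
      (∀ w : E, ‖w‖ ≤ r → h T - 1 < f (x + T • a + w) - T * b) := by
    have h1 := hcap t₀ ht₀.le ht₀T.le _ hη'
    have h2 := hcap T hT.le le_rfl (h T - 1) (by linarith)
    have h3 : ∀ᶠ r in 𝓝[>] (0 : ℝ), r ∈ Set.Ioo 0 (ε - T * ‖a‖) :=
      Ioo_mem_nhdsGT (sub_pos.2 hTε)
    obtain ⟨r, ⟨h1, h2⟩, h3⟩ := ((h1.and h2).and h3).exists
    exact ⟨r, h3.1, by linarith [h3.2], h1, h2⟩
  let K : Set E := {y | t₀ ≤ s y ∧ s y ≤ T ∧ ‖z y‖ ≤ r}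
  have hKball : K ⊆ Metric.ball x ε := fun y hy => by
    rw [Metric.mem_ball, dist_eq_norm]
    have : y - x = s y • a + z y := by simp only [z]; abel
    calc ‖y - x‖ ≤ ‖s y • a‖ + ‖z y‖ := this ▸ norm_add_le _ _
      _ ≤ T * ‖a‖ + r := by
        rw [norm_smul, Real.norm_of_nonneg (ht₀.le.trans hy.1)]
        exact add_le_add (mul_le_mul_of_nonneg_right hy.2.1 ha2.le) hy.2.2
      _ < ε := hrε
  have hKclosed : IsClosed K :=
    (isClosed_le continuous_const hs_cont).inter
      ((isClosed_le hs_cont continuous_const).inter (isClosed_le hz_cont.norm continuous_const))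
  have hKcomp : IsCompact K :=
    Metric.isCompact_of_isClosed_isBounded hKclosed (Metric.isBounded_ball.subset hKball)
  have hmem₁ : x + t₁ • a ∈ K := by
    refine ⟨?_, ?_, ?_⟩
    · rw [hs_line]; exact ht₀₁.le
    · rw [hs_line]; exact ht₁T.le
    · rw [hz_line]; simpa using hr.le
  have hfK : ContinuousOn (fun y => f y - s y * b) K :=
    (hf.mono hKball).sub (by fun_prop)
  obtain ⟨m, hm⟩ := hKcomp.bddBelow_image hfK
  -- On the lateral boundary `‖z‖ = r` the penalty `k * ‖z‖ ^ 2` outweighs the lower bound `m`.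
  obtain ⟨k, hk0, hk⟩ : ∃ k : ℝ, 0 ≤ k ∧ h t₁ + η < m + k * r ^ 2 := by
    refine ⟨(|h t₁ + η - m| + 1) / r ^ 2, by positivity, ?_⟩
    rw [div_mul_cancel₀ _ (by positivity)]
    linarith [le_abs_self (h t₁ + η - m)]
  -- At `x + t₁ • a` the value of `f - θ` is `h t₁ + η`, while on every face of the tube it is
  -- larger: by the choice of `η` at `s = t₀`, of `M` at `s = T`, of `k` on the side. So the minimum
  -- is interior, and there `θ` has slope `b - η M exp(…) < b` along `a`.
  let θ : E → ℝ := fun y => s y * b - η * Real.exp (M * (s y - t₁)) - k * ‖z y‖ ^ 2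
  have hθ_cont : Continuous θ := by fun_prop
  obtain ⟨y, hyK, hymin⟩ := hKcomp.exists_isMinOn ⟨_, hmem₁⟩
    ((hf.mono hKball).sub hθ_cont.continuousOn)
  have hyle : f y - θ y ≤ h t₁ + η := by
    have := hymin hmem₁
    simp only [Set.mem_ofPred_eq, θ, hs_line, hz_line, sub_self, mul_zero, Real.exp_zero, norm_zero,
      Pi.sub_apply] at this
    simp only [h, θ]
    linarith
  have hθy : f y - θ y = f y - s y * b + η * Real.exp (M * (s y - t₁)) + k * ‖z y‖ ^ 2 := by
    simp only [θ]; ring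
  have hkz : 0 ≤ k * ‖z y‖ ^ 2 := by positivity
  have hs0 : t₀ < s y := by
    refine lt_of_le_of_ne hyK.1 fun heq => ?_
    have h1 := hcap₀ (z y) hyK.2.2
    rw [heq, ← hdecomp y] at h1
    have : 0 < η * Real.exp (M * (s y - t₁)) := by positivity
    linarith
  have hsT : s y < T := by
    refine lt_of_le_of_ne hyK.2.1 fun heq => ?_
    have h1 := hcapT (z y) hyK.2.2
    rw [← heq, ← hdecomp y] at h1
    rw [heq] at h1
    rw [heq] at hθy
    linarith
  have hzr : ‖z y‖ < r := by
    refine lt_of_le_of_ne hyK.2.2 fun heq => ?_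
    have h1 : m ≤ f y - s y * b := hm ⟨y, hyK, rfl⟩
    have : 0 < η * Real.exp (M * (s y - t₁)) := by positivity
    rw [heq] at hθy
    linarith
  have hKnhds : K ∈ 𝓝 y := by
    filter_upwards [hs_cont.continuousAt.eventually (lt_mem_nhds hs0),
      hs_cont.continuousAt.eventually (gt_mem_nhds hsT),
      hz_cont.norm.continuousAt.eventually (gt_mem_nhds hzr)] with w h1 h2 h3
    exact ⟨h1.le, h2.le, h3.le⟩
  -- This is why the tube starts at `t₀ > 0`: the touching hypothesis says nothing at `x` itself.
  have hyx : y ≠ x := by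
    rintro rfl
    have : s y = 0 := by simp [s]
    linarith
  have hθd : DifferentiableAt ℝ θ y := by
    have h0 : Differentiable ℝ fun y => y - x := by fun_prop
    have h1 : Differentiable ℝ s := by
      simpa [s, div_eq_inv_mul, Function.comp_def] using
        ((innerSL ℝ a).differentiable.comp h0).const_mul (‖a‖ ^ 2)⁻¹
    have h2 : Differentiable ℝ fun y => ‖z y‖ ^ 2 :=
      Differentiable.norm_sq ℝ (by fun_prop)
    fun_prop
  have hb := htouch y (hKball hyK) hyx θ _ hθd.hasFDerivAt (hymin.isLocalMin hKnhds)
  have hline : HasDerivAt (fun t : ℝ => y + t • a) a 0 := by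
    simpa using ((hasDerivAt_id (0 : ℝ)).smul_const a).const_add y
  have hd1 : HasDerivAt (fun t : ℝ => θ (y + t • a)) (fderiv ℝ θ y a) 0 := by
    have : HasFDerivAt θ (fderiv ℝ θ y) (y + (0 : ℝ) • a) := by simpa using hθd.hasFDerivAt
    exact this.comp_hasDerivAt 0 hline
  have hd2 : HasDerivAt (fun t : ℝ => θ (y + t • a))
      (b - η * (Real.exp (M * (s y - t₁)) * M)) 0 := by
    have : (fun t : ℝ => θ (y + t • a)) = fun t : ℝ =>
        (s y + t) * b - η * Real.exp (M * (s y + t - t₁)) - k * ‖z y‖ ^ 2 := by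
      ext t; simp only [θ, hs_add, hz_add]
    rw [this]
    have e1 : HasDerivAt (fun t : ℝ => s y + t) 1 0 := (hasDerivAt_id (0 : ℝ)).const_add _
    have := ((e1.mul_const b).sub ((((e1.sub_const t₁).const_mul M).exp).const_mul η)).sub_const
      (k * ‖z y‖ ^ 2)
    simpa using this
  have := hd1.unique hd2
  have : 0 < η * (Real.exp (M * (s y - t₁)) * M) := by positivity
  linarith

/-! ### Proximal normal cones and normals realized by balls -/

section Cones

variable {H : Type*} [NormedAddCommGroup H] [InnerProductSpace ℝ H]

theorem zero_mem_proximalNormalCone (Q : Set H) (x : H) : 0 ∈ proximalNormalCone Q x :=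
  ⟨0, le_rfl, fun y _ => by simp⟩

theorem smul_mem_proximalNormalCone {Q : Set H} {x v : H} (hv : v ∈ proximalNormalCone Q x)
    {t : ℝ} (ht : 0 ≤ t) : t • v ∈ proximalNormalCone Q x := by
  obtain ⟨σ, hσ, h⟩ := hv
  refine ⟨t * σ, by positivity, fun y hy => ?_⟩
  rw [real_inner_smul_left, mul_assoc]
  exact mul_le_mul_of_nonneg_left (h y hy) ht

theorem add_mem_proximalNormalCone {Q : Set H} {x v w : H} (hv : v ∈ proximalNormalCone Q x)
    (hw : w ∈ proximalNormalCone Q x) : v + w ∈ proximalNormalCone Q x := by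
  obtain ⟨σ, hσ, h⟩ := hv
  obtain ⟨τ, hτ, h'⟩ := hw
  refine ⟨σ + τ, by positivity, fun y hy => ?_⟩
  rw [inner_add_left, add_mul]
  exact add_le_add (h y hy) (h' y hy)

theorem convex_proximalNormalCone (Q : Set H) (x : H) : Convex ℝ (proximalNormalCone Q x) :=
  fun _ hv _ hw _ _ ha hb _ =>
    add_mem_proximalNormalCone (smul_mem_proximalNormalCone hv ha)
      (smul_mem_proximalNormalCone hw hb)

theorem RealizedByBall.smul {Q : Set H} {x v : H} {r t : ℝ} (h : RealizedByBall Q x v r)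
    (ht : 0 ≤ t) : RealizedByBall Q x (t • v) r := by
  intro y hy
  rw [real_inner_smul_left, norm_smul, Real.norm_of_nonneg ht]
  calc t * inner ℝ v (y - x) ≤ t * (‖v‖ / (2 * r) * ‖y - x‖ ^ 2) :=
        mul_le_mul_of_nonneg_left (h y hy) ht
    _ = _ := by ring

theorem RealizedByBall.mem_proximalNormalCone {Q : Set H} {x v : H} {r : ℝ}
    (h : RealizedByBall Q x v r) (hr : 0 ≤ r) : v ∈ proximalNormalCone Q x :=
  ⟨_, by positivity, h⟩

/-- Normals realized by balls whose radii converge to a positive limit pass to the limit. -/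
theorem RealizedByBall.of_tendsto {Q : Set H} {x v : H} {r : ℝ} {xs vs : ℕ → H} {rs : ℕ → ℝ}
    (h : ∀ n, RealizedByBall Q (xs n) (vs n) (rs n)) (hx : Tendsto xs atTop (𝓝 x))
    (hv : Tendsto vs atTop (𝓝 v)) (hr : Tendsto rs atTop (𝓝 r)) (hr0 : r ≠ 0) :
    RealizedByBall Q x v r := by
  intro y hy
  exact le_of_tendsto_of_tendsto' (hv.inner (hx.const_sub y))
    ((hv.norm.div (hr.const_mul 2) (by positivity)).mul ((hx.const_sub y).norm.pow 2))
    fun n => h n y hy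

end Cones

/-! ### Normals to the hypograph at points touched from below -/

section Touching

variable {d : ℕ} {Ω : Set (EuclideanSpace ℝ (Fin d))} {f : EuclideanSpace ℝ (Fin d) → ℝ}
  {x : EuclideanSpace ℝ (Fin d)} {v : WithLp 2 (EuclideanSpace ℝ (Fin d) × ℝ)}

/-- The proximal inequality in coordinates. -/
theorem mem_hypoNormalCone_iff : v ∈ hypoNormalCone Ω f x ↔ ∃ σ : ℝ, 0 ≤ σ ∧
    ∀ y ∈ Ω, ∀ β ≤ f y, inner ℝ v.fst (y - x) + v.snd * (β - f x) ≤
      σ * (‖y - x‖ ^ 2 + (β - f x) ^ 2) := by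
  refine exists_congr fun σ => and_congr_right fun _ => ⟨fun h y hy β hβ => ?_, fun h p hp => ?_⟩
  · have := h (WithLp.toLp 2 (y, β)) ⟨hy, hβ⟩
    rw [WithLp.prod_inner_apply, WithLp.prod_norm_sq_eq_of_L2] at this
    simpa [mul_comm] using this
  · have := h p.fst hp.1 p.snd hp.2
    rw [WithLp.prod_inner_apply, WithLp.prod_norm_sq_eq_of_L2]
    simpa [mul_comm] using this

/-- The hypograph contains the points below `(x, f x)`; testing at depth `t` gives `-v.snd ≤ σ * t`
for every `t > 0`. -/
theorem snd_nonneg_of_mem_hypoNormalCone (hx : x ∈ Ω) (hv : v ∈ hypoNormalCone Ω f x) :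
    0 ≤ v.snd := by
  obtain ⟨σ, hσ, h⟩ := mem_hypoNormalCone_iff.1 hv
  by_contra! hneg
  have key : ∀ t : ℝ, 0 < t → -v.snd ≤ σ * t := fun t ht => by
    have := h x hx (f x - t) (by linarith)
    simp only [sub_self, inner_zero_right, norm_zero] at this
    have h2 : -v.snd * t ≤ σ * t * t := by nlinarith
    exact le_of_mul_le_mul_right h2 ht
  have h1 := key (-v.snd / (2 * (σ + 1))) (by apply div_pos <;> linarith)
  have h2 : σ * (-v.snd / (2 * (σ + 1))) ≤ -v.snd / 2 := by
    rw [mul_div_assoc', div_le_div_iff₀ (by linarith) (by norm_num)]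
    nlinarith
  linarith

/-- A function that touches `f` from below determines the slope of every proximal normal. -/
theorem fst_eq_of_touching (hΩ : Ω ∈ 𝓝 x) (hv : v ∈ hypoNormalCone Ω f x)
    {θ : EuclideanSpace ℝ (Fin d) → ℝ} {ξ : EuclideanSpace ℝ (Fin d)}
    (hθ : HasGradientAt θ ξ x) (hmin : IsLocalMin (fun z => f z - θ z) x) :
    v.fst = -(v.snd • ξ) := by
  obtain ⟨σ, hσ, h⟩ := mem_hypoNormalCone_iff.1 hv
  let F : EuclideanSpace ℝ (Fin d) → ℝ := fun z =>
    inner ℝ v.fst (z - x) + v.snd * (θ z - θ x) - σ * (‖z - x‖ ^ 2 + (θ z - θ x) ^ 2)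
  -- Near `x` the graph of `θ + (f x - θ x)` lies in the hypograph, so the proximal inequality
  -- applies along it. The quadratic terms of `F` have zero derivative at `x`.
  have hmax : IsLocalMax F x := by
    filter_upwards [hmin, hΩ] with z hz hzΩ
    have := h z hzΩ (f x + (θ z - θ x)) (by linarith)
    simp only [F, sub_self, inner_zero_right, norm_zero]
    simp only [add_sub_cancel_left] at this
    linarith
  have hid : HasFDerivAt (fun z => z - x) (ContinuousLinearMap.id ℝ _) x :=
    (hasFDerivAt_id x).sub_const x
  have hθ' : HasFDerivAt (fun z => θ z - θ x) (InnerProductSpace.toDual ℝ _ ξ) x :=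
    hθ.hasFDerivAt.sub_const _
  have hF := ((((hasFDerivAt_const v.fst x).inner ℝ hid).add (hθ'.const_mul v.snd)).sub
    ((hid.norm_sq.add (hθ'.pow 2)).const_mul σ))
  have h0 := hmax.hasFDerivAt_eq_zero hF
  refine ext_inner_right ℝ fun w => ?_
  have := DFunLike.congr_fun h0 w
  simp [fderivInnerCLM_apply] at this
  rw [inner_neg_left, real_inner_smul_left]
  linarith

/-- If the hypograph has a non-trivial proximal normal at a point where `f` is touched from below
by a differentiable function, then `f` is differentiable there. -/
theorem hasGradientAt_of_touching (hΩ : Ω ∈ 𝓝 x) (hf : ContinuousAt f x)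
    (hv : v ∈ hypoNormalCone Ω f x) (hv0 : v ≠ 0)
    {θ : EuclideanSpace ℝ (Fin d) → ℝ} {ξ : EuclideanSpace ℝ (Fin d)}
    (hθ : HasGradientAt θ ξ x) (hmin : IsLocalMin (fun z => f z - θ z) x) :
    HasGradientAt f ξ x := by
  have hslope := fst_eq_of_touching hΩ hv hθ hmin
  have hpos : 0 < v.snd := by
    refine (snd_nonneg_of_mem_hypoNormalCone (mem_of_mem_nhds hΩ) hv).lt_of_ne fun h0 => hv0 ?_
    rw [← h0, zero_smul, neg_zero] at hslope
    exact WithLp.ofLp_injective 2 (Prod.ext hslope h0.symm)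
  obtain ⟨σ, hσ, h⟩ : ∃ σ : ℝ, 0 ≤ σ ∧ ∀ y ∈ Ω,
      f y - f x - inner ℝ ξ (y - x) ≤ σ * (‖y - x‖ ^ 2 + (f y - f x) ^ 2) := by
    obtain ⟨σ, hσ, h⟩ := mem_hypoNormalCone_iff.1 hv
    refine ⟨σ / v.snd, by positivity, fun y hy => ?_⟩
    have := h y hy (f y) le_rfl
    rw [hslope, inner_neg_left, real_inner_smul_left] at this
    rw [div_mul_eq_mul_div, le_div_iff₀ hpos]
    linarith
  have hδ : Tendsto (fun y => f y - f x) (𝓝 x) (𝓝 0) := by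
    exact tendsto_sub_nhds_zero_iff.2 hf
  have hh : Tendsto (fun y => y - x) (𝓝 x) (𝓝 0) := by
    exact tendsto_sub_nhds_zero_iff.2 tendsto_id
  have hθo : (fun y => θ y - θ x - inner ℝ ξ (y - x)) =o[𝓝 x] fun y => y - x :=
    hasGradientAt_iff_isLittleO.1 hθ
  -- The term `σ (f y - f x) ^ 2` is not yet known to be small relative to `‖y - x‖`. By continuity
  -- it is at most `|f y - f x| / 2` near `x` and can be absorbed on the left, giving a Lipschitz
  -- estimate at `x`; the square is then `o(‖y - x‖)`.
  have hbound : ∀ᶠ y in 𝓝 x, |f y - f x| ≤ (2 * (‖ξ‖ + 1 + σ)) * ‖y - x‖ := by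
    have e1 : ∀ᶠ y in 𝓝 x, |f y - f x| < 1 / (2 * (σ + 1)) :=
      hδ.abs.eventually (gt_mem_nhds (by simp; positivity))
    have e2 : ∀ᶠ y in 𝓝 x, ‖y - x‖ < 1 := hh.norm.eventually (gt_mem_nhds (by simp))
    filter_upwards [e1, e2, hmin, hΩ, hθo.bound one_pos] with y h1 h2 h3 h4 h5
    have hξ := abs_le.1 (abs_real_inner_le_norm ξ (y - x))
    have h6 := abs_le.1 (Real.norm_eq_abs _ ▸ h5)
    have h7 := h y h4
    have hn := norm_nonneg (y - x)
    have hξ0 := norm_nonneg ξ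
    rw [lt_div_iff₀ (by positivity)] at h1
    have h8 : σ * (f y - f x) ^ 2 ≤ |f y - f x| / 2 := by
      rw [← sq_abs]; nlinarith [abs_nonneg (f y - f x)]
    have h9 : σ * ‖y - x‖ ^ 2 ≤ σ * ‖y - x‖ := by
      apply mul_le_mul_of_nonneg_left _ hσ; nlinarith
    have h10 : 0 ≤ σ * ‖y - x‖ := by positivity
    have h11 : 0 ≤ ‖ξ‖ * ‖y - x‖ := by positivity
    rcases le_total 0 (f y - f x) with hs | hs
    · rw [abs_of_nonneg hs] at h8 ⊢
      linarith [hξ.2]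
    · rw [abs_of_nonpos hs] at h8 ⊢
      linarith [hξ.1, h6.1]
  have hO : (fun y => f y - f x) =O[𝓝 x] fun y => y - x :=
    Asymptotics.IsBigO.of_bound _ hbound
  have hsq : (fun y => ‖y - x‖ ^ 2 + (f y - f x) ^ 2) =o[𝓝 x] fun y => y - x := by
    have h2 := Asymptotics.isLittleO_pow_sub_sub x one_lt_two
    exact h2.add ((hO.norm_right.pow 2).trans_isLittleO h2)
  rw [hasGradientAt_iff_isLittleO]
  have hsum := hθo.norm_left.add (hsq.const_mul_left σ)
  refine Asymptotics.IsBigO.trans_isLittleO ?_ hsum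
  refine Asymptotics.IsBigO.of_bound 1 ?_
  filter_upwards [hmin, hΩ] with y h1 h2
  have h3 := h y h2
  have h4 := neg_abs_le (θ y - θ x - inner ℝ ξ (y - x))
  have h5 : 0 ≤ σ * (‖y - x‖ ^ 2 + (f y - f x) ^ 2) := by positivity
  rw [Real.norm_eq_abs, Real.norm_eq_abs, Real.norm_eq_abs, one_mul]
  refine le_trans (abs_le.2 ⟨?_, ?_⟩) (le_abs_self _) <;>
    linarith [abs_nonneg (θ y - θ x - inner ℝ ξ (y - x))]

end Touching

/-! ### Gradient normals and their limits -/

section LimitNormals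

variable {d : ℕ}

/-- The normal `(-Df(y), 1)` to the hypograph of `f` at a point of differentiability. -/
def gradNormal (f : EuclideanSpace ℝ (Fin d) → ℝ) (y : EuclideanSpace ℝ (Fin d)) :
    WithLp 2 (EuclideanSpace ℝ (Fin d) × ℝ) :=
  WithLp.toLp 2 (-gradient f y, 1)

/-- The unit normal to the hypograph of `f` at a point of differentiability. -/
def unitGradNormal (f : EuclideanSpace ℝ (Fin d) → ℝ) (y : EuclideanSpace ℝ (Fin d)) :
    WithLp 2 (EuclideanSpace ℝ (Fin d) × ℝ) :=
  ‖gradNormal f y‖⁻¹ • gradNormal f y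

/-- The points of `Ω` other than `x` at which `f` is differentiable. -/
def diffPoints (Ω : Set (EuclideanSpace ℝ (Fin d))) (f : EuclideanSpace ℝ (Fin d) → ℝ)
    (x : EuclideanSpace ℝ (Fin d)) : Set (EuclideanSpace ℝ (Fin d)) :=
  {y | y ∈ Ω \ {x} ∧ DifferentiableAt ℝ f y}

/-- The limits of unit normals at points of differentiability that converge to `x`. -/
def limitNormals (Ω : Set (EuclideanSpace ℝ (Fin d))) (f : EuclideanSpace ℝ (Fin d) → ℝ)
    (x : EuclideanSpace ℝ (Fin d)) : Set (WithLp 2 (EuclideanSpace ℝ (Fin d) × ℝ)) :=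
  {w | MapClusterPt w (𝓝[diffPoints Ω f x] x) (unitGradNormal f)}

variable {Ω : Set (EuclideanSpace ℝ (Fin d))} {f ρ : EuclideanSpace ℝ (Fin d) → ℝ}
  {x y : EuclideanSpace ℝ (Fin d)} {u v w ζ : WithLp 2 (EuclideanSpace ℝ (Fin d) × ℝ)}

theorem gradNormal_ne_zero : gradNormal f y ≠ 0 := fun h => by
  have : (gradNormal f y).snd = 0 := by rw [h]; rfl
  exact one_ne_zero this

theorem norm_gradNormal_pos : 0 < ‖gradNormal f y‖ := norm_pos_iff.2 gradNormal_ne_zero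

theorem norm_unitGradNormal : ‖unitGradNormal f y‖ = 1 :=
  norm_smul_inv_norm (𝕜 := ℝ) gradNormal_ne_zero

theorem inner_gradNormal : inner ℝ (gradNormal f y) u = u.snd - inner ℝ (gradient f y) u.fst := by
  rw [WithLp.prod_inner_apply]
  simp [gradNormal, inner_neg_left]
  ring

/-- Since `f` touches itself from below, the normal supplied by the sphere condition is a positive
multiple of `gradNormal f y`, and realization by a ball is invariant under scaling. The radius `ρ y`
is what survives in limits. -/
theorem realizedByBall_gradNormal (hΩ : IsOpen Ω) (hsphere : HypoExteriorSphere Ω f ρ)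
    (hy : y ∈ Ω) (hd : DifferentiableAt ℝ f y) :
    RealizedByBall (hypo Ω f) (WithLp.toLp 2 (y, f y)) (gradNormal f y) (ρ y) := by
  obtain ⟨v, hv0, hv, hr⟩ := hsphere y hy
  have hslope := fst_eq_of_touching (hΩ.mem_nhds hy) hv hd.hasGradientAt
    (.of_forall fun z => by simp)
  have heq : v = v.snd • gradNormal f y := WithLp.ofLp_injective 2 <| Prod.ext
    (by simpa [gradNormal] using hslope) (by simp [gradNormal])
  have hpos : 0 < v.snd := by
    refine (snd_nonneg_of_mem_hypoNormalCone hy hv).lt_of_ne fun h0 => hv0 ?_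
    rw [heq, ← h0, zero_smul]
  have : gradNormal f y = v.snd⁻¹ • v := by
    rw [eq_inv_smul_iff₀ hpos.ne', ← heq]
  rw [this]
  exact hr.smul (by positivity)

theorem exists_seq_of_mem_limitNormals (hw : w ∈ limitNormals Ω f x) :
    ∃ u : ℕ → EuclideanSpace ℝ (Fin d), (∀ n, u n ∈ Ω \ {x} ∧ DifferentiableAt ℝ f (u n)) ∧
      Tendsto u atTop (𝓝 x) ∧ Tendsto (fun n => unitGradNormal f (u n)) atTop (𝓝 w) := by
  have hne : NeBot (𝓝[diffPoints Ω f x] x ⊓ comap (unitGradNormal f) (𝓝 w)) := by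
    rw [neBot_inf_comap_iff_map, inf_comm]; exact hw
  obtain ⟨u, hu⟩ := exists_seq_tendsto (𝓝[diffPoints Ω f x] x ⊓ comap (unitGradNormal f) (𝓝 w))
  rw [tendsto_inf, tendsto_comap_iff, tendsto_nhdsWithin_iff] at hu
  obtain ⟨⟨h1, h2⟩, h3⟩ := hu
  obtain ⟨N, hN⟩ := eventually_atTop.1 h2
  exact ⟨fun n => u (n + N), fun n => hN _ (by omega), h1.comp (tendsto_add_atTop_nat N),
    h3.comp (tendsto_add_atTop_nat N)⟩

theorem norm_eq_one_of_mem_limitNormals (hw : w ∈ limitNormals Ω f x) : ‖w‖ = 1 := by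
  obtain ⟨u, -, -, h⟩ := exists_seq_of_mem_limitNormals hw
  exact tendsto_nhds_unique h.norm (by simp [norm_unitGradNormal])

theorem isCompact_limitNormals : IsCompact (limitNormals Ω f x) := by
  refine (isCompact_sphere (0 : WithLp 2 (EuclideanSpace ℝ (Fin d) × ℝ)) 1).of_isClosed_subset
    isClosed_setOfPred_clusterPt fun w hw => ?_
  simpa using norm_eq_one_of_mem_limitNormals hw

/-- Limits of unit normals are the normalized reachable gradients and the unit horizontal ones. -/
theorem limitNormals_subset : limitNormals Ω f x ⊆
    (fun ζ => ‖ζ‖⁻¹ • ζ) '' negLift (reachableGradients Ω f x) 1 ∪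
      negLift (horizReachableGradients Ω f x) 0 := by
  intro w hw
  obtain ⟨u, hu, hux, hlim⟩ := exists_seq_of_mem_limitNormals hw
  have hw1 := norm_eq_one_of_mem_limitNormals hw
  have hfst : Tendsto (fun n => ‖gradNormal f (u n)‖⁻¹ • gradient f (u n)) atTop (𝓝 (-w.fst)) := by
    have := ((WithLp.prod_continuous_ofLp 2 _ _).fst.tendsto w).comp hlim
    simpa [Function.comp_def, unitGradNormal, gradNormal] using this.neg
  have hsnd : Tendsto (fun n => ‖gradNormal f (u n)‖⁻¹) atTop (𝓝 w.snd) := by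
    have := ((WithLp.prod_continuous_ofLp 2 _ _).snd.tendsto w).comp hlim
    simpa [Function.comp_def, unitGradNormal, gradNormal] using this
  -- The last coordinate of `w` is the limit of `1 / ‖(-Df, 1)‖`: it vanishes when the gradients
  -- blow up and is positive when they converge.
  have hnonneg : 0 ≤ w.snd := ge_of_tendsto' hsnd fun n => by positivity
  rcases hnonneg.eq_or_lt with h0 | hpos
  · right
    have hwn : ‖w.fst‖ = 1 := by
      have := WithLp.prod_norm_sq_eq_of_L2 w
      rw [hw1, ← h0] at this
      have h2 := norm_nonneg w.fst
      simp at this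
      nlinarith
    have hratio : Tendsto (fun n => ‖gradNormal f (u n)‖⁻¹ * ‖gradient f (u n)‖) atTop (𝓝 1) := by
      have := hfst.norm
      simpa [norm_smul, hwn] using this
    refine ⟨-w.fst, ⟨fun h => ?_, u, hu, hux, ?_, ?_⟩, ?_⟩
    · rw [neg_eq_zero] at h; simp [h] at hwn
    · rw [norm_neg, hwn, inv_one]
      have := (hratio.inv₀ one_ne_zero).smul hfst
      rw [inv_one] at this
      refine this.congr fun n => ?_
      have := (norm_gradNormal_pos (f := f) (y := u n)).ne'
      rw [smul_smul, mul_inv, inv_inv, mul_right_comm, mul_inv_cancel₀ this, one_mul]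
    · have hinf : Tendsto (fun n => ‖gradNormal f (u n)‖) atTop atTop := by
        have : Tendsto (fun n => ‖gradNormal f (u n)‖⁻¹) atTop (𝓝[>] 0) :=
          tendsto_nhdsWithin_iff.2 ⟨h0 ▸ hsnd, .of_forall fun n => inv_pos.2 norm_gradNormal_pos⟩
        exact this.inv_tendsto_nhdsGT_zero.congr fun n => inv_inv _
      have := hratio.pos_mul_atTop one_pos hinf
      refine this.congr fun n => ?_
      have := (norm_gradNormal_pos (f := f) (y := u n)).ne'
      field_simp
    · exact WithLp.ofLp_injective 2 (Prod.ext (by simp) h0)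
  · left
    have hlimg : Tendsto (fun n => gradient f (u n)) atTop (𝓝 (w.snd⁻¹ • -w.fst)) := by
      refine ((hsnd.inv₀ hpos.ne').smul hfst).congr fun n => ?_
      have := (norm_gradNormal_pos (f := f) (y := u n)).ne'
      rw [inv_inv, smul_smul, mul_inv_cancel₀ this, one_smul]
    refine ⟨_, ⟨_, ⟨u, hu, hux, hlimg⟩, rfl⟩, ?_⟩
    have heq : (WithLp.toLp 2 (-(w.snd⁻¹ • -w.fst), (1 : ℝ)) :
        WithLp 2 (EuclideanSpace ℝ (Fin d) × ℝ)) = w.snd⁻¹ • w :=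
      WithLp.ofLp_injective 2 (Prod.ext (by simp) (by simp [hpos.ne']))
    simp only [heq, norm_smul, hw1, norm_inv, Real.norm_of_nonneg hnonneg, mul_one, inv_inv,
      smul_smul, mul_inv_cancel₀ hpos.ne', one_smul]

/-- If all gradient normals near `x` had nonpositive product with `u`, the mean value inequality
would put `(x, f x) + T • u` in the hypograph for small `T > 0`. The proximal inequality there,
divided by `T`, reads `ζ · u ≤ σ T ‖u‖²`, and `T → 0` is a contradiction. -/
theorem exists_diffPoint_inner_pos_of_fst_ne_zero (hΩ : IsOpen Ω) (hf : ContinuousOn f Ω)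
    (hsphere : HypoExteriorSphere Ω f ρ) (hx : x ∈ Ω) (hζ : ζ ∈ hypoNormalCone Ω f x)
    (hu : u.fst ≠ 0) (hpos : 0 < inner ℝ ζ u) {ε : ℝ} (hε : 0 < ε) :
    ∃ y ∈ diffPoints Ω f x, dist y x < ε ∧ 0 < inner ℝ (gradNormal f y) u := by
  obtain ⟨δ, hδ, hδΩ⟩ := Metric.isOpen_iff.1 hΩ x hx
  by_contra! hcon
  have hmv : ∀ T : ℝ, 0 < T → T * ‖u.fst‖ < min ε δ → f x + T * u.snd ≤ f (x + T • u.fst) := by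
    intro T hT hT'
    have hsub : Metric.ball x (min ε δ) ⊆ Ω :=
      (Metric.ball_subset_ball (min_le_right _ _)).trans hδΩ
    refine le_add_of_touching hu (hf.mono hsub) hT hT' fun y hy hyx θ θ' hθ hmin => ?_
    obtain ⟨v, hv0, hv, -⟩ := hsphere y (hsub hy)
    have hy' := hΩ.mem_nhds (hsub hy)
    have hg := hasGradientAt_of_touching hy' (hf.continuousAt hy') hv hv0
      (hasFDerivAt_iff_hasGradientAt.1 hθ) hmin
    have := hcon y ⟨⟨hsub hy, hyx⟩, hg.differentiableAt⟩
      ((Metric.mem_ball.1 hy).trans_le (min_le_left _ _))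
    rw [inner_gradNormal, hg.gradient, InnerProductSpace.toDual_symm_apply] at this
    linarith
  obtain ⟨σ, hσ, h⟩ := mem_hypoNormalCone_iff.1 hζ
  have hle : ∀ᶠ T in 𝓝[>] (0 : ℝ),
      inner ℝ ζ u ≤ σ * T * (‖u.fst‖ ^ 2 + u.snd ^ 2) := by
    have hup : 0 < ‖u.fst‖ := norm_pos_iff.2 hu
    filter_upwards [Ioo_mem_nhdsGT (show 0 < min ε δ / ‖u.fst‖ by positivity)] with T hT
    have hTu : T * ‖u.fst‖ < min ε δ := (lt_div_iff₀ hup).1 hT.2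
    have hmem : x + T • u.fst ∈ Ω := by
      apply hδΩ
      rw [Metric.mem_ball, dist_eq_norm, add_sub_cancel_left, norm_smul,
        Real.norm_of_nonneg hT.1.le]
      exact hTu.trans_le (min_le_right _ _)
    have := h _ hmem _ (hmv T hT.1 hTu)
    rw [add_sub_cancel_left, add_sub_cancel_left, norm_smul, Real.norm_of_nonneg hT.1.le,
      real_inner_smul_right] at this
    rw [WithLp.prod_inner_apply]
    have hsn : inner ℝ (WithLp.ofLp ζ).2 (WithLp.ofLp u).2 = ζ.snd * u.snd := by simp [mul_comm]
    rw [hsn]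
    refine le_of_mul_le_mul_left ?_ hT.1
    calc T * (inner ℝ ζ.fst u.fst + ζ.snd * u.snd)
        = T * inner ℝ ζ.fst u.fst + ζ.snd * (T * u.snd) := by ring
      _ ≤ _ := this
      _ = _ := by ring
  have hlim : Tendsto (fun T : ℝ => σ * T * (‖u.fst‖ ^ 2 + u.snd ^ 2)) (𝓝[>] 0) (𝓝 0) := by
    have : Continuous fun T : ℝ => σ * T * (‖u.fst‖ ^ 2 + u.snd ^ 2) := by fun_prop
    simpa using (this.tendsto 0).mono_left nhdsWithin_le_nhds
  exact absurd (ge_of_tendsto hlim hle) (not_le.2 hpos)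

/-- A direction which has positive product with a proximal normal at `x` has positive product with
a gradient normal at points of differentiability arbitrarily close to `x`. -/
theorem exists_diffPoint_inner_pos (hd : 1 ≤ d) (hΩ : IsOpen Ω) (hf : ContinuousOn f Ω)
    (hsphere : HypoExteriorSphere Ω f ρ) (hx : x ∈ Ω) (hζ : ζ ∈ hypoNormalCone Ω f x)
    (hpos : 0 < inner ℝ ζ u) {ε : ℝ} (hε : 0 < ε) :
    ∃ y ∈ diffPoints Ω f x, dist y x < ε ∧ 0 < inner ℝ (gradNormal f y) u := by
  by_cases hu : u.fst = 0
  · have hsn : inner ℝ ζ u = ζ.snd * u.snd := by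
      rw [WithLp.prod_inner_apply, show u.ofLp.1 = 0 from hu]
      simp [mul_comm]
    have hupos : 0 < u.snd :=
      pos_of_mul_pos_right (hsn ▸ hpos) (snd_nonneg_of_mem_hypoNormalCone hx hζ)
    -- A vertical `u` gives no segment in the domain, so it is tilted by some `e ≠ 0` without losing
    -- positivity. Only the existence of the point `y` is used: every gradient normal has product
    -- `u.snd > 0` with `u`.
    obtain ⟨e, he0, he⟩ : ∃ e : EuclideanSpace ℝ (Fin d), e ≠ 0 ∧ 0 ≤ inner ℝ ζ.fst e := by
      have : Nonempty (Fin d) := ⟨⟨0, hd⟩⟩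
      obtain ⟨e, he⟩ := exists_ne (0 : EuclideanSpace ℝ (Fin d))
      rcases le_total 0 (inner ℝ ζ.fst e) with h | h
      · exact ⟨e, he, h⟩
      · exact ⟨-e, neg_ne_zero.2 he, by rw [inner_neg_right]; linarith⟩
    have hpos' : 0 < inner ℝ ζ (WithLp.toLp 2 (e, u.snd)) := by
      rw [WithLp.prod_inner_apply]
      rw [hsn] at hpos
      simp only [RCLike.inner_apply, conj_trivial]
      change 0 < inner ℝ ζ.fst e + u.snd * ζ.snd
      linarith
    obtain ⟨y, hy, hyx, -⟩ :=
      exists_diffPoint_inner_pos_of_fst_ne_zero hΩ hf hsphere hx hζ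
        (u := WithLp.toLp 2 (e, u.snd)) he0 hpos' hε
    exact ⟨y, hy, hyx, by rw [inner_gradNormal, hu, inner_zero_right, sub_zero]; exact hupos⟩
  · exact exists_diffPoint_inner_pos_of_fst_ne_zero hΩ hf hsphere hx hζ hu hpos hε

/-- A direction which has nonnegative product with a nonzero limit of proximal normals at `x` has
nonnegative product with a limit of normals at points of differentiability. -/
theorem exists_limitNormal_inner_nonneg (hd : 1 ≤ d) (hΩ : IsOpen Ω) (hf : ContinuousOn f Ω)
    (hsphere : HypoExteriorSphere Ω f ρ) (hx : x ∈ Ω) (hζ : ζ ∈ closure (hypoNormalCone Ω f x))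
    (hζ0 : ζ ≠ 0) (hpos : 0 ≤ inner ℝ ζ u) :
    ∃ w ∈ limitNormals Ω f x, 0 ≤ inner ℝ w u := by
  -- Adding a small multiple of `ζ` to `u` makes the product strictly positive, hence also positive
  -- for some true normal near `ζ`.
  have hstep : ∀ n : ℕ, ∃ y ∈ diffPoints Ω f x, dist y x < 1 / ((n : ℝ) + 1) ∧
      0 < inner ℝ (gradNormal f y) (u + (1 / ((n : ℝ) + 1)) • ζ) := by
    intro n
    have hn : 0 < 1 / ((n : ℝ) + 1) := by positivity
    have h1 : 0 < inner ℝ ζ (u + (1 / ((n : ℝ) + 1)) • ζ) := by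
      rw [inner_add_right, real_inner_smul_right]
      have := real_inner_self_pos.2 hζ0
      positivity
    have hcont : Continuous fun z : WithLp 2 (EuclideanSpace ℝ (Fin d) × ℝ) =>
        inner ℝ z (u + (1 / ((n : ℝ) + 1)) • ζ) := by fun_prop
    obtain ⟨ζ', hζ', hmem⟩ := mem_closure_iff_nhds.1 hζ _
      (hcont.continuousAt.eventually (lt_mem_nhds h1))
    exact exists_diffPoint_inner_pos hd hΩ hf hsphere hx hmem hζ' hn
  choose y hy hyx hyu using hstep
  have hylim : Tendsto y atTop (𝓝 x) :=
    tendsto_iff_dist_tendsto_zero.2 <| squeeze_zero (fun _ => dist_nonneg) (fun n => (hyx n).le)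
      tendsto_one_div_add_atTop_nhds_zero_nat
  obtain ⟨w, -, φ, hφ, hw⟩ := (isCompact_sphere
    (0 : WithLp 2 (EuclideanSpace ℝ (Fin d) × ℝ)) 1).tendsto_subseq
      (x := fun n => unitGradNormal f (y n)) fun n => by simp [norm_unitGradNormal]
  have hyw : Tendsto (y ∘ φ) atTop (𝓝[diffPoints Ω f x] x) :=
    tendsto_nhdsWithin_iff.2 ⟨hylim.comp hφ.tendsto_atTop, .of_forall fun n => hy _⟩
  refine ⟨w, MapClusterPt.of_comp hyw (Tendsto.mapClusterPt hw), ?_⟩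
  have hlim : Tendsto (fun n : ℕ => u + (1 / ((n : ℝ) + 1)) • ζ) atTop (𝓝 u) := by
    simpa using (tendsto_one_div_add_atTop_nhds_zero_nat (𝕜 := ℝ).smul_const ζ).const_add u
  refine ge_of_tendsto' (hw.inner (hlim.comp hφ.tendsto_atTop)) fun n => ?_
  simp only [Function.comp_apply, unitGradNormal, real_inner_smul_left]
  exact mul_nonneg (by positivity) (hyu _).le

end LimitNormals

/-! ### The cone generated by reachable normals -/

section Reachable

variable {d : ℕ} {Ω : Set (EuclideanSpace ℝ (Fin d))} {f ρ : EuclideanSpace ℝ (Fin d) → ℝ}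
  {x : EuclideanSpace ℝ (Fin d)}

theorem tendsto_graph (hx : ContinuousAt f x) {u : ℕ → EuclideanSpace ℝ (Fin d)}
    (hu : Tendsto u atTop (𝓝 x)) :
    Tendsto (fun n => (WithLp.toLp 2 (u n, f (u n)) : WithLp 2 (EuclideanSpace ℝ (Fin d) × ℝ)))
      atTop (𝓝 (WithLp.toLp 2 (x, f x))) :=
  ((WithLp.prod_continuous_toLp 2 _ _).tendsto (x, f x)).comp
    (hu.prodMk_nhds (hx.tendsto.comp hu))

theorem negLift_reachableGradients_subset (hΩ : IsOpen Ω) (hf : ContinuousOn f Ω)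
    (hρ : ContinuousOn ρ Ω) (hρpos : ∀ x ∈ Ω, 0 < ρ x) (hsphere : HypoExteriorSphere Ω f ρ)
    (hx : x ∈ Ω) : negLift (reachableGradients Ω f x) 1 ⊆ hypoNormalCone Ω f x := by
  rintro _ ⟨v, ⟨u, hu, hux, hlim⟩, rfl⟩
  refine RealizedByBall.mem_proximalNormalCone (RealizedByBall.of_tendsto
    (fun n => realizedByBall_gradNormal hΩ hsphere (hu n).1.1 (hu n).2)
    (tendsto_graph (hf.continuousAt (hΩ.mem_nhds hx)) hux) ?_
    ((hρ.continuousAt (hΩ.mem_nhds hx)).tendsto.comp hux) (hρpos x hx).ne') (hρpos x hx).le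
  exact ((WithLp.prod_continuous_toLp 2 _ _).tendsto (-v, (1 : ℝ))).comp
    (hlim.neg.prodMk_nhds tendsto_const_nhds)

theorem negLift_horizReachableGradients_subset (hΩ : IsOpen Ω) (hf : ContinuousOn f Ω)
    (hρ : ContinuousOn ρ Ω) (hρpos : ∀ x ∈ Ω, 0 < ρ x) (hsphere : HypoExteriorSphere Ω f ρ)
    (hx : x ∈ Ω) : negLift (horizReachableGradients Ω f x) 0 ⊆ hypoNormalCone Ω f x := by
  rintro _ ⟨v, ⟨hv0, u, hu, hux, hlim, hinf⟩, rfl⟩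
  have hmem : (WithLp.toLp 2 (-(‖v‖⁻¹ • v), (0 : ℝ)) :
      WithLp 2 (EuclideanSpace ℝ (Fin d) × ℝ)) ∈ hypoNormalCone Ω f x := by
    refine RealizedByBall.mem_proximalNormalCone (RealizedByBall.of_tendsto
      (fun n => (realizedByBall_gradNormal hΩ hsphere (hu n).1.1 (hu n).2).smul
        (inv_nonneg.2 (norm_nonneg (gradient f (u n)))))
      (tendsto_graph (hf.continuousAt (hΩ.mem_nhds hx)) hux) ?_
      ((hρ.continuousAt (hΩ.mem_nhds hx)).tendsto.comp hux) (hρpos x hx).ne') (hρpos x hx).le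
    -- Dividing `(-Df, 1)` by `‖Df‖` sends the last coordinate to `0`.
    refine (((WithLp.prod_continuous_toLp 2 _ _).tendsto (-(‖v‖⁻¹ • v), (0 : ℝ))).comp
      (hlim.neg.prodMk_nhds (tendsto_inv_atTop_zero.comp hinf))).congr fun n => ?_
    exact WithLp.ofLp_injective 2 (Prod.ext (by simp [gradNormal]) (by simp [gradNormal]))
  have : _ ∈ hypoNormalCone Ω f x := smul_mem_proximalNormalCone hmem (norm_nonneg v)
  convert this using 1
  rw [← WithLp.toLp_smul, Prod.smul_mk, smul_zero, smul_neg, smul_smul,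
    mul_inv_cancel₀ (norm_ne_zero_iff.2 hv0), one_smul]

theorem smul_mem_horizReachableGradients {v : EuclideanSpace ℝ (Fin d)}
    (hv : v ∈ horizReachableGradients Ω f x) {t : ℝ} (ht : 0 < t) :
    t • v ∈ horizReachableGradients Ω f x := by
  obtain ⟨hv0, u, hu, hux, hlim, hinf⟩ := hv
  refine ⟨smul_ne_zero ht.ne' hv0, u, hu, hux, ?_, hinf⟩
  rw [norm_smul, Real.norm_of_nonneg ht.le, smul_smul, mul_inv, mul_right_comm,
    inv_mul_cancel₀ ht.ne', one_mul]
  exact hlim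

/-- The nonnegative multiples of reachable normals. -/
def reachableRays (Ω : Set (EuclideanSpace ℝ (Fin d))) (f : EuclideanSpace ℝ (Fin d) → ℝ)
    (x : EuclideanSpace ℝ (Fin d)) : Set (WithLp 2 (EuclideanSpace ℝ (Fin d) × ℝ)) :=
  {w | ∃ t : ℝ, 0 ≤ t ∧ ∃ v ∈ negLift (horizReachableGradients Ω f x) 0 ∪
    negLift (reachableGradients Ω f x) 1, w = t • v}

theorem smul_mem_reachableRays {w : WithLp 2 (EuclideanSpace ℝ (Fin d) × ℝ)}
    (hw : w ∈ reachableRays Ω f x) {t : ℝ} (ht : 0 ≤ t) : t • w ∈ reachableRays Ω f x := by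
  obtain ⟨s, hs, v, hv, rfl⟩ := hw
  exact ⟨t * s, by positivity, v, hv, smul_smul _ _ _⟩

theorem limitNormals_subset_reachableRays : limitNormals Ω f x ⊆ reachableRays Ω f x := by
  intro w hw
  rcases limitNormals_subset hw with ⟨ζ, hζ, rfl⟩ | h
  · exact ⟨_, by positivity, ζ, .inr hζ, rfl⟩
  · exact ⟨1, zero_le_one, w, .inl h, (one_smul _ _).symm⟩

theorem smul_mem_convexHull_reachableRays {w : WithLp 2 (EuclideanSpace ℝ (Fin d) × ℝ)}
    (hw : w ∈ convexHull ℝ (reachableRays Ω f x)) {t : ℝ} (ht : 0 ≤ t) :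
    t • w ∈ convexHull ℝ (reachableRays Ω f x) := by
  have : t • w ∈ t • convexHull ℝ (reachableRays Ω f x) := Set.smul_mem_smul_set hw
  rw [← convexHull_smul] at this
  refine convexHull_mono ?_ this
  rintro _ ⟨v, hv, rfl⟩
  exact smul_mem_reachableRays hv ht

theorem convexHull_reachableRays_subset
    (h : negLift (reachableGradients Ω f x) 1 ∪ negLift (horizReachableGradients Ω f x) 0 ⊆
      hypoNormalCone Ω f x) :
    convexHull ℝ (reachableRays Ω f x) ⊆ hypoNormalCone Ω f x := by
  refine convexHull_min ?_ (convex_proximalNormalCone _ _)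
  rintro _ ⟨t, ht, v, hv, rfl⟩
  exact smul_mem_proximalNormalCone (h hv.symm) ht

/-- In a pointed convex cone, zero is not a convex combination of nonzero elements. -/
theorem zero_notMem_convexHull_of_isPointed {H : Type*} [NormedAddCommGroup H]
    [InnerProductSpace ℝ H] {C K : Set H} (hC : Convex ℝ C) (hcone : IsCone C)
    (hpt : IsPointed C) (hK : K ⊆ C) (h0 : 0 ∉ K) : (0 : H) ∉ convexHull ℝ K := by
  -- If `a • v + b • w = 0`, then `a • v` lies in both `C` and `-C`, so it vanishes.
  have hconv : Convex ℝ (C \ {0}) := by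
    rintro v ⟨hv, hv0⟩ w ⟨hw, hw0⟩ a b ha hb hab
    refine ⟨hC hv hw ha hb hab, fun h => ?_⟩
    have hav : a • v = 0 := by
      have : a • v ∈ C ∩ -C := ⟨hcone v hv a ha, by
        rw [Set.mem_neg, ← eq_neg_of_add_eq_zero_right h]; exact hcone w hw b hb⟩
      rwa [hpt] at this
    rw [Set.mem_singleton_iff, hav, zero_add] at h
    have ha0 : a = 0 := (smul_eq_zero.1 hav).resolve_right hv0
    have hb0 : b = 0 := (smul_eq_zero.1 h).resolve_right hw0
    linarith
  intro h
  have hKC : K ⊆ C \ {0} := fun w hw => ⟨hK hw, fun h => h0 (Set.mem_singleton_iff.1 h ▸ hw)⟩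
  exact (convexHull_min hKC hconv h).2 rfl

theorem convex_halfLine {H : Type*} [NormedAddCommGroup H] [InnerProductSpace ℝ H] (ζ : H) :
    Convex ℝ (halfLine ζ) := by
  rintro _ ⟨s, hs, rfl⟩ _ ⟨t, ht, rfl⟩ a b ha hb -
  exact ⟨a * s + b * t, by positivity, by module⟩

theorem isClosed_halfLine {H : Type*} [NormedAddCommGroup H] [InnerProductSpace ℝ H] {ζ : H}
    (hζ : ζ ≠ 0) : IsClosed (halfLine ζ) := by
  have : halfLine ζ = (fun t : ℝ => t • ζ) '' Set.Ici 0 := by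
    ext w
    exact exists_congr fun t => and_congr_right fun _ => eq_comm
  rw [this]
  exact (isClosedEmbedding_smul_left hζ).isClosedMap _ isClosed_Ici

/-- A ray that cannot be strictly separated from a compact set meets its convex hull. -/
theorem exists_smul_mem_convexHull {H : Type*} [NormedAddCommGroup H] [InnerProductSpace ℝ H]
    [FiniteDimensional ℝ H] {K : Set H} (hK : IsCompact K) {ζ : H} (hζ : ζ ≠ 0)
    (h : ∀ u : H, 0 ≤ inner ℝ ζ u → ∃ w ∈ K, 0 ≤ inner ℝ w u) :
    ∃ t : ℝ, 0 ≤ t ∧ t • ζ ∈ convexHull ℝ K := by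
  have : CompleteSpace H := FiniteDimensional.complete ℝ H
  by_contra! hcon
  have hdisj : Disjoint (convexHull ℝ K) (halfLine ζ) := by
    refine Set.disjoint_left.2 ?_
    rintro _ hmem ⟨t, ht, rfl⟩
    exact hcon t ht hmem
  obtain ⟨g, s, t, hs, hst, ht⟩ := geometric_hahn_banach_compact_closed (convex_convexHull ℝ K)
    (isCompact_convexHull_of_finiteDimensional hK) (convex_halfLine ζ) (isClosed_halfLine hζ) hdisj
  have ht0 : t < 0 := by
    have := ht 0 ⟨0, le_rfl, (zero_smul ℝ ζ).symm⟩
    rwa [map_zero] at this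
  -- If `g ζ < 0`, the half line would reach the level `t`, which `g` must exceed on it.
  have hgζ : 0 ≤ g ζ := by
    by_contra! hneg
    have := ht ((t / g ζ) • ζ) ⟨_, (div_pos_of_neg_of_neg ht0 hneg).le, rfl⟩
    rw [map_smul, smul_eq_mul, div_mul_cancel₀ _ hneg.ne] at this
    exact lt_irrefl _ this
  have hu : ∀ w, inner ℝ w ((InnerProductSpace.toDual ℝ H).symm g) = g w := fun w => by
    rw [real_inner_comm]; exact InnerProductSpace.toDual_symm_apply
  obtain ⟨w, hw, hwu⟩ := h _ (hgζ.trans_eq (hu ζ).symm)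
  rw [hu] at hwu
  linarith [hs w (subset_convexHull ℝ _ hw)]

/-- Bounding the closure rather than the cone yields closedness and the hull formula at once, since
the hull lies in the cone. -/
theorem closure_hypoNormalCone_subset (hd : 1 ≤ d) (hΩ : IsOpen Ω) (hf : ContinuousOn f Ω)
    (hsphere : HypoExteriorSphere Ω f ρ) (hx : x ∈ Ω)
    (hsub : negLift (reachableGradients Ω f x) 1 ∪ negLift (horizReachableGradients Ω f x) 0 ⊆
      hypoNormalCone Ω f x) (hpt : IsPointed (hypoNormalCone Ω f x)) :
    closure (hypoNormalCone Ω f x) ⊆ convexHull ℝ (reachableRays Ω f x) := by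
  have key : ∀ ζ ∈ closure (hypoNormalCone Ω f x), ζ ≠ 0 →
      ζ ∈ convexHull ℝ (reachableRays Ω f x) := by
    intro ζ hζ hζ0
    obtain ⟨t, ht, hmem⟩ := exists_smul_mem_convexHull isCompact_limitNormals hζ0 fun u hu =>
      exists_limitNormal_inner_nonneg hd hΩ hf hsphere hx hζ hζ0 hu
    rcases ht.eq_or_lt with rfl | ht
    · rw [zero_smul] at hmem
      refine absurd hmem (zero_notMem_convexHull_of_isPointed (convex_proximalNormalCone _ _)
        (fun v hv t ht => smul_mem_proximalNormalCone hv ht) hpt ?_ fun h => ?_)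
      · exact limitNormals_subset_reachableRays.trans ((subset_convexHull ℝ _).trans
          (convexHull_reachableRays_subset hsub))
      · simpa using norm_eq_one_of_mem_limitNormals h
    · have := smul_mem_convexHull_reachableRays
        (convexHull_mono limitNormals_subset_reachableRays hmem) (inv_nonneg.2 ht.le)
      rwa [smul_smul, inv_mul_cancel₀ ht.ne', one_smul] at this
  intro ζ hζ
  by_cases h0 : ζ = 0
  -- The origin lies in the hull only if the hull is nonempty; the sphere condition supplies a
  -- nonzero normal to scale by `0`.
  · obtain ⟨v, hv0, hv, -⟩ := hsphere x hx
    have := smul_mem_convexHull_reachableRays (key v (subset_closure hv) hv0) le_rfl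
    rwa [zero_smul, ← h0] at this
  · exact key ζ hζ h0

theorem smul_mem_convexHull_horizReachableGradients {q : EuclideanSpace ℝ (Fin d)}
    (hq : q ∈ convexHull ℝ (horizReachableGradients Ω f x ∪ {0})) {t : ℝ} (ht : 0 ≤ t) :
    t • q ∈ convexHull ℝ (horizReachableGradients Ω f x ∪ {0}) := by
  have : t • q ∈ t • convexHull ℝ (horizReachableGradients Ω f x ∪ {0}) :=
    Set.smul_mem_smul_set hq
  rw [← convexHull_smul] at this
  refine convexHull_mono ?_ this
  rintro _ ⟨v, hv | rfl, rfl⟩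
  · rcases ht.eq_or_lt with rfl | ht
    · right; simp
    · exact .inl (smul_mem_horizReachableGradients hv ht)
  · right; simp

/-- Elements of the convex cone generated by the reachable normals split into a multiple of a
convex combination of reachable gradients and a horizontal part. -/
theorem decompose_of_mem_convexHull_reachableRays
    {w : WithLp 2 (EuclideanSpace ℝ (Fin d) × ℝ)}
    (hw : w ∈ convexHull ℝ (reachableRays Ω f x)) :
    0 ≤ w.snd ∧ ∃ q ∈ convexHull ℝ (horizReachableGradients Ω f x ∪ {0}), ∃ p,
      (w.snd ≠ 0 → p ∈ convexHull ℝ (reachableGradients Ω f x)) ∧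
        w.fst = -(w.snd • p + q) := by
  -- The point `p` is constrained only when `w.snd ≠ 0`, because there may be no reachable gradients
  -- at all. In a combination of two elements of `D` the points `p` are averaged with weights
  -- proportional to their vertical coordinates.
  let D : Set (WithLp 2 (EuclideanSpace ℝ (Fin d) × ℝ)) :=
    {w | 0 ≤ w.snd ∧ ∃ q ∈ convexHull ℝ (horizReachableGradients Ω f x ∪ {0}), ∃ p,
      (w.snd ≠ 0 → p ∈ convexHull ℝ (reachableGradients Ω f x)) ∧ w.fst = -(w.snd • p + q)}
  have hzero : (0 : EuclideanSpace ℝ (Fin d)) ∈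
      convexHull ℝ (horizReachableGradients Ω f x ∪ {0}) := subset_convexHull ℝ _ (.inr rfl)
  have hgen : reachableRays Ω f x ⊆ D := by
    rintro _ ⟨t, ht, _, ⟨v, hv, rfl⟩ | ⟨v, hv, rfl⟩, rfl⟩
    · refine ⟨by simp, t • v, smul_mem_convexHull_horizReachableGradients
        (subset_convexHull ℝ _ (.inl hv)) ht, 0, fun h => absurd (by simp) h, by simp⟩
    · exact ⟨by simpa using ht, 0, hzero, v, fun _ => subset_convexHull ℝ _ hv, by simp⟩
  have hconv : Convex ℝ D := by
    rintro w ⟨hw, q, hq, p, hp, hwe⟩ w' ⟨hw', q', hq', p', hp', hwe'⟩ a b ha hb hab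
    have hc : (a • w + b • w').snd = a * w.snd + b * w'.snd := by simp
    have hc1 : (a • w + b • w').fst = a • w.fst + b • w'.fst := by simp
    have h1 : 0 ≤ a * w.snd := by positivity
    have h2 : 0 ≤ b * w'.snd := by positivity
    refine ⟨by rw [hc]; positivity, a • q + b • q', convex_convexHull ℝ _ hq hq' ha hb hab, ?_⟩
    rw [hc, hc1, hwe, hwe']
    rcases h1.eq_or_lt with h1 | h1
    · refine ⟨p', fun h => hp' fun h0 => h (by rw [← h1, h0]; ring), ?_⟩
      have : a • w.snd • p = 0 := by rw [smul_smul, ← h1, zero_smul]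
      rw [← h1, smul_neg, smul_add, this]
      module
    · rcases h2.eq_or_lt with h2 | h2
      · refine ⟨p, fun h => hp fun h0 => h (by rw [← h2, h0]; ring), ?_⟩
        have : b • w'.snd • p' = 0 := by rw [smul_smul, ← h2, zero_smul]
        rw [← h2, smul_neg b, smul_add b, this]
        module
      · have hs : 0 < a * w.snd + b * w'.snd := by positivity
        refine ⟨(a * w.snd / (a * w.snd + b * w'.snd)) • p +
          (b * w'.snd / (a * w.snd + b * w'.snd)) • p', fun _ => ?_, ?_⟩
        · refine convex_convexHull ℝ _ (hp fun h => ?_) (hp' fun h => ?_) (by positivity)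
            (by positivity) (by field_simp)
          · rw [h, mul_zero] at h1; exact lt_irrefl _ h1
          · rw [h, mul_zero] at h2; exact lt_irrefl _ h2
        · rw [smul_add, smul_smul, smul_smul, mul_div_cancel₀ _ hs.ne', mul_div_cancel₀ _ hs.ne']
          module
  exact convexHull_min hgen hconv hw

end Reachable

end HypoSphere

end

/-! ### The main theorem -/

open HypoSphere in
theorem proposition2p5 (d : ℕ) (hd : 1 ≤ d) (Ω : Set (EuclideanSpace ℝ (Fin d))) (hΩ : IsOpen Ω)
    (f : EuclideanSpace ℝ (Fin d) → ℝ) (hf : ContinuousOn f Ω)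
    (ρ : EuclideanSpace ℝ (Fin d) → ℝ) (hρ : ContinuousOn ρ Ω) (hρpos : ∀ x ∈ Ω, 0 < ρ x)
    (hsphere : HypoSphere.HypoExteriorSphere Ω f ρ)
    (x : EuclideanSpace ℝ (Fin d)) (hx : x ∈ Ω) :
    -- (i)
    ((HypoSphere.reachableGradients Ω f x ∪
        HypoSphere.horizReachableGradients Ω f x).Nonempty ∧
      HypoSphere.negLift (HypoSphere.reachableGradients Ω f x) 1 ∪
        HypoSphere.negLift (HypoSphere.horizReachableGradients Ω f x) 0 ⊆
          HypoSphere.hypoNormalCone Ω f x) ∧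
    -- (ii)
    (∀ C : Set (WithLp 2 (EuclideanSpace ℝ (Fin d) × ℝ)),
      HypoSphere.IsCone C → Convex ℝ C → IsClosed C →
      HypoSphere.negLift (HypoSphere.reachableGradients Ω f x) 1 ∪
        HypoSphere.negLift (HypoSphere.horizReachableGradients Ω f x) 0 ⊆ C →
      C ⊆ HypoSphere.hypoNormalCone Ω f x →
      ∀ (ξ : EuclideanSpace ℝ (Fin d)) (l : ℝ), 0 ≤ l →
        ‖(WithLp.toLp 2 (-ξ, l) : WithLp 2 (EuclideanSpace ℝ (Fin d) × ℝ))‖ = 1 →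
        ∀ R : Set (WithLp 2 (EuclideanSpace ℝ (Fin d) × ℝ)),
          HypoSphere.IsExposedRay C R → WithLp.toLp 2 (-ξ, l) ∈ R →
          WithLp.toLp 2 (-ξ, l) ∈
            (fun ζ : WithLp 2 (EuclideanSpace ℝ (Fin d) × ℝ) => ‖ζ‖⁻¹ • ζ) ''
                HypoSphere.negLift (HypoSphere.reachableGradients Ω f x) 1 ∪
              HypoSphere.negLift (HypoSphere.horizReachableGradients Ω f x) 0) ∧
    -- (iii)
    (HypoSphere.IsPointed (HypoSphere.hypoNormalCone Ω f x) →
      IsClosed (HypoSphere.hypoNormalCone Ω f x) ∧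
      HypoSphere.hypoNormalCone Ω f x =
        convexHull ℝ {w : WithLp 2 (EuclideanSpace ℝ (Fin d) × ℝ) |
          ∃ t : ℝ, 0 ≤ t ∧
            ∃ v ∈ HypoSphere.negLift (HypoSphere.horizReachableGradients Ω f x) 0 ∪
                HypoSphere.negLift (HypoSphere.reachableGradients Ω f x) 1, w = t • v} ∧
      HypoSphere.horizProxSupergradients Ω f x =
        convexHull ℝ (HypoSphere.horizReachableGradients Ω f x ∪ {0}) ∧
      HypoSphere.proxSupergradients Ω f x =
        convexHull ℝ (HypoSphere.reachableGradients Ω f x) +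
          HypoSphere.horizProxSupergradients Ω f x) := by
  have hsub : negLift (reachableGradients Ω f x) 1 ∪ negLift (horizReachableGradients Ω f x) 0 ⊆
      hypoNormalCone Ω f x :=
    Set.union_subset (negLift_reachableGradients_subset hΩ hf hρ hρpos hsphere hx)
      (negLift_horizReachableGradients_subset hΩ hf hρ hρpos hsphere hx)
  refine ⟨⟨?_, hsub⟩, ?_, fun hpt => ?_⟩
  · obtain ⟨v, hv0, hv, -⟩ := hsphere x hx
    obtain ⟨w, hw, -⟩ := exists_limitNormal_inner_nonneg hd hΩ hf hsphere hx (subset_closure hv)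
      hv0 (u := 0) (by simp)
    rcases limitNormals_subset hw with ⟨_, ⟨p, hp, -⟩, -⟩ | ⟨p, hp, -⟩
    exacts [⟨p, .inl hp⟩, ⟨p, .inr hp⟩]
  · rintro C hcone - - hKC hCN ξ l - hnorm R ⟨ζ, hζ0, rfl, hRC, e, -, hζe, hexp⟩ hmem
    have hne : (WithLp.toLp 2 (-ξ, l) : WithLp 2 (EuclideanSpace ℝ (Fin d) × ℝ)) ≠ 0 := by
      rintro h; simp [h] at hnorm
    have hinner : inner ℝ (WithLp.toLp 2 (-ξ, l) : WithLp 2 (EuclideanSpace ℝ (Fin d) × ℝ)) e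
        = 0 := by
      obtain ⟨t, -, ht⟩ := hmem
      rw [ht, real_inner_smul_left, hζe, mul_zero]
    -- Exposedness makes `e` negative on `C` off the ray, so this limit normal lies on the ray;
    -- having norm one, it is the given vector.
    obtain ⟨w, hw, hwe⟩ := exists_limitNormal_inner_nonneg hd hΩ hf hsphere hx
      (subset_closure (hCN (hRC hmem))) hne hinner.ge
    have hw1 := norm_eq_one_of_mem_limitNormals hw
    have hwC : w ∈ C := by
      obtain ⟨t, ht, v, hv, rfl⟩ := limitNormals_subset_reachableRays hw
      exact hcone v (hKC hv.symm) t ht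
    have hwR : w ∈ halfLine ζ := by
      by_contra hnot
      refine absurd (hexp w ⟨hwC, ?_⟩) (not_lt.2 hwe)
      rintro (h | h)
      · exact hnot h
      · rw [Set.mem_singleton_iff.1 h, norm_zero] at hw1
        exact zero_ne_one hw1
    obtain ⟨s, hs, rfl⟩ := hwR
    obtain ⟨t, ht, hteq⟩ := hmem
    have hst : t = s := by
      rw [hteq, norm_smul, Real.norm_of_nonneg ht] at hnorm
      rw [norm_smul, Real.norm_of_nonneg hs] at hw1
      exact mul_right_cancel₀ (norm_ne_zero_iff.2 hζ0) (hnorm.trans hw1.symm)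
    rw [hteq, hst]
    exact limitNormals_subset hw
  · have hcl := closure_hypoNormalCone_subset hd hΩ hf hsphere hx hsub hpt
    have hhull := convexHull_reachableRays_subset hsub
    have heq : hypoNormalCone Ω f x = convexHull ℝ (reachableRays Ω f x) :=
      (subset_closure.trans hcl).antisymm hhull
    have hlin : IsLinearMap ℝ fun v : EuclideanSpace ℝ (Fin d) =>
        (WithLp.toLp 2 (-v, (0 : ℝ)) : WithLp 2 (EuclideanSpace ℝ (Fin d) × ℝ)) :=
      ⟨fun v w => WithLp.ofLp_injective 2 (Prod.ext (by simp [add_comm]) (by simp)),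
        fun c v => WithLp.ofLp_injective 2 (Prod.ext (by simp) (by simp))⟩
    have hhoriz : horizProxSupergradients Ω f x =
        convexHull ℝ (horizReachableGradients Ω f x ∪ {0}) := by
      apply Set.Subset.antisymm
      · intro v hv
        obtain ⟨-, q, hq, p, -, hpq⟩ :=
          decompose_of_mem_convexHull_reachableRays (heq.subset (Set.mem_ofPred.1 hv))
        have : v = q := by simpa using hpq
        rwa [this]
      · refine convexHull_min ?_ ((convex_proximalNormalCone _ _).is_linear_preimage hlin)
        rintro v (hv | rfl)
        · exact hsub (.inr ⟨v, hv, rfl⟩)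
        · change WithLp.toLp 2 (-(0 : EuclideanSpace ℝ (Fin d)), (0 : ℝ)) ∈ hypoNormalCone Ω f x
          rw [neg_zero]
          exact zero_mem_proximalNormalCone _ _
    refine ⟨closure_subset_iff_isClosed.1 (hcl.trans hhull), heq, hhoriz, ?_⟩
    have hprox : Convex ℝ (proxSupergradients Ω f x) := by
      intro v hv w hw a b ha hb hab
      have : _ ∈ hypoNormalCone Ω f x := convex_proximalNormalCone _ _ hv hw ha hb hab
      change WithLp.toLp 2 (-(a • v + b • w), (1 : ℝ)) ∈ hypoNormalCone Ω f x
      convert this using 1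
      exact WithLp.ofLp_injective 2 (Prod.ext (by simp [add_comm]) (by simp [hab]))
    apply Set.Subset.antisymm
    · intro v hv
      obtain ⟨-, q, hq, p, hp, hpq⟩ := decompose_of_mem_convexHull_reachableRays
        (heq.subset (Set.mem_ofPred.1 hv))
      -- The vertical coordinate is `1` here, so `p` is a genuine convex combination of reachable
      -- gradients.
      refine ⟨p, hp (by simp), q, hhoriz ▸ hq, ?_⟩
      have : -v = -(p + q) := by simpa using hpq
      exact (neg_injective this).symm
    · rintro _ ⟨p, hp, q, hq, rfl⟩
      have hp' : p ∈ proxSupergradients Ω f x :=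
        by
        refine convexHull_min (fun v hv => ?_) hprox hp
        exact hsub (.inl ⟨v, hv, rfl⟩)
      have : _ ∈ hypoNormalCone Ω f x := add_mem_proximalNormalCone hp' hq
      change WithLp.toLp 2 (-(p + q), (1 : ℝ)) ∈ hypoNormalCone Ω f x
      convert this using 1
      exact WithLp.ofLp_injective 2 (Prod.ext (by simp [add_comm]) (by simp))
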